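/- **Setting (abstract Tile Assembly Model).** Fix a set of glue labels, each label $g$ having a strength $s_g\in\mathbb{N}$. A tile type is a unit square (not rotatable) with a glue label on each of its four sides. For a finite set $T$ of tile types, an assembly is a partial function $\alpha:\mathbb{Z}^2\dashrightarrow T$. Two tiles at adjacent points are bound with strength $s_g$ if their abutting sides both carry the label $g$, and with strength $0$ if the abutting labels differ. An assembly is $\tau$-stable if for every partition of its tiles into two nonempty parts the total strength of the bonds between the parts is at least $\tau$. A tile assembly system (TAS) is a triple $\mathcal{T}=(T,\sigma,\tau)$ with $T$ a finite set of tile types, $\tau\in\mathbb{N}$ the temperature, and $\sigma$ a finite $\tau$-stable assembly, the seed. Write $\alpha\to_1\beta$ if $\beta$ arises from $\alpha$ by placing one tile at an empty point at which its bonds to the tiles of $\alpha$ at the four neighbouring points have total strength at least $\tau$. An assembly is producible if it arises from $\sigma$ by finitely many such steps. $\mathcal{T}$ *finitely self-assembles* $X\subseteq\mathbb{Z}^2$ if for every finite producible assembly $\alpha$ there is a finite or infinite sequence of such steps starting from $\alpha$ whose result (the last assembly, or the union of all of them) has domain exactly $X$. **The H fractal.** Let $G=\{(0,0),(0,1),(0,2),(1,1),(2,0),(2,1),(2,2)\}$,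 $H_1=G$, and $H_{i+1}=\{a+3^i b : a\in H_i,\ b\in G\}$ for $i\ge 1$. The H fractal is $\mathbf{H}=\bigcup_{i\ge1}H_i\subset\mathbb{N}^2\subset\mathbb{Z}^2$, the discrete self-similar fractal with generator $G$. **Theorem 1.** No tile assembly system $\mathcal{T}=(T,\sigma,\tau)$, at any temperature $\tau\in\mathbb{N}$ and with any finite $\tau$-stable seed $\sigma$, finitely self-assembles $\mathbf{H}$. -/

import Mathlib

/-! ### The abstract Tile Assembly Model -/

/-- The four sides of a unit square tile. -/
inductive Side : Type
  | north
  | east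
  | south
  | west
  deriving DecidableEq

instance : Fintype Side where
  elems := {.north, .east, .south, .west}
  complete := by intro d; cases d <;> decide

namespace Side

/-- The side that abuts on a given side. -/
def opposite : Side → Side
  | north => south
  | east => west
  | south => north
  | west => east

/-- The unit vector pointing out of a given side. -/
def vec : Side → ℤ × ℤ
  | north => (0, 1)
  | east => (1, 0)
  | south => (0, -1)
  | west => (-1, 0)

end Side

/-- A tile type assigns a glue label to each of its four sides. Strengths are a function of
the label (see `TAS.strength`), so equal labels always have equal strengths. -/
abbrev TileType (Glue : Type*) : Type _ := Side → Glue

/-- An assembly: a partial function from the lattice `ℤ²` to a set of tile types. -/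
abbrev Assembly (Tile : Type*) : Type _ := ℤ × ℤ → Option Tile

/-- The set of points at which an assembly has a tile. -/
def Assembly.dom {Tile : Type*} (α : Assembly Tile) : Set (ℤ × ℤ) := {p | α p ≠ none}

open Classical in
/-- The strength with which a tile of type `t` is bound across its side `d` to an adjacent tile
of type `u`: the strength of the common glue if the abutting labels agree, and `0` otherwise. -/
noncomputable def bondStrength {Glue : Type*} (strength : Glue → ℕ) (t u : TileType Glue)
    (d : Side) : ℕ :=
  if t d = u d.opposite then strength (t d) else 0

/-- The total strength with which a tile of type `t` at the point `p` is bound to the tiles of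
the assembly `α` at the four neighbours of `p`. -/
noncomputable def attachStrength {Glue : Type*} (strength : Glue → ℕ)
    {T : Finset (TileType Glue)} (α : Assembly T) (p : ℤ × ℤ) (t : T) : ℕ :=
  ∑ d : Side, (α (p + d.vec)).elim 0 fun u => bondStrength strength t.1 u.1 d

open Classical in
/-- The strength of the cut that separates the tiles of `α` at points of `A` from all its other
tiles: the sum of the strengths of all bonds between the two parts. -/
noncomputable def cutStrength {Glue : Type*} (strength : Glue → ℕ)
    {T : Finset (TileType Glue)} (α : Assembly T) (A : Set (ℤ × ℤ)) : ENNReal :=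
  ∑' e : (ℤ × ℤ) × Side,
    if e.1 ∈ A ∧ e.1 + e.2.vec ∉ A then
      (α e.1).elim 0 fun t => (α (e.1 + e.2.vec)).elim 0 fun u =>
        (bondStrength strength t.1 u.1 e.2 : ENNReal)
    else 0

/-- An assembly is `τ`-stable if every cut of its binding graph has strength at least `τ`. -/
def IsStable {Glue : Type*} (strength : Glue → ℕ) {T : Finset (TileType Glue)} (τ : ℕ)
    (α : Assembly T) : Prop :=
  ∀ A : Set (ℤ × ℤ), A.Nonempty → A ⊂ α.dom → (τ : ENNReal) ≤ cutStrength strength α A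

/-- A tile assembly system: a finite set of tile types, a finite stable seed assembly and a
temperature, over a set `Glue` of glue labels with given strengths. -/
structure TAS (Glue : Type*) where
  strength : Glue → ℕ
  tiles : Finset (TileType Glue)
  seed : Assembly tiles
  temperature : ℕ
  seed_finite : seed.dom.Finite
  seed_stable : IsStable strength temperature seed

namespace TAS

variable {Glue : Type*} (𝒯 : TAS Glue)

/-- `𝒯.Step α β`: the assembly `β` is obtained from `α` by the stable binding of one tile at a
point at which `α` has no tile. -/
def Step (α β : Assembly 𝒯.tiles) : Prop :=
  ∃ (p : ℤ × ℤ) (t : 𝒯.tiles), α p = none ∧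
    𝒯.temperature ≤ attachStrength 𝒯.strength α p t ∧ β = Function.update α p (some t)

/-- An assembly is producible if it arises from the seed by finitely many attachments. -/
def Producible (α : Assembly 𝒯.tiles) : Prop := Relation.ReflTransGen 𝒯.Step 𝒯.seed α

/-- `𝒯.GrowsInto α β`: the assembly `β` is the result of a finite or infinite assembly sequence
that starts from `α` (a finite sequence is continued by repeating its last assembly). -/
def GrowsInto (α β : Assembly 𝒯.tiles) : Prop :=
  ∃ s : ℕ → Assembly 𝒯.tiles, s 0 = α ∧
    (∀ n, 𝒯.Step (s n) (s (n + 1)) ∨ s (n + 1) = s n) ∧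
    ∀ p t, β p = some t ↔ ∃ n, s n p = some t

/-- `𝒯` finitely self-assembles `X` if every finite producible assembly can grow into an assembly
that has tiles exactly at the points of `X`. -/
def FinitelySelfAssembles (X : Set (ℤ × ℤ)) : Prop :=
  ∀ α : Assembly 𝒯.tiles, 𝒯.Producible α → α.dom.Finite →
    ∃ β : Assembly 𝒯.tiles, 𝒯.GrowsInto α β ∧ β.dom = X

end TAS

/-! ### Discrete self-similar fractals -/

/-- The stages of the discrete self-similar fractal with generator `G`, where
`dssfStage G n` is the `(n + 1)`-st stage: `X₁ = G` and `Xᵢ₊₁ = Xᵢ + (wⁱ, hⁱ) G` with `w` and `h`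
the width and the height of `G`. -/
def dssfStage (G : Finset (ℕ × ℕ)) : ℕ → Set (ℕ × ℕ)
  | 0 => {p | p ∈ G}
  | n + 1 => {p | ∃ a ∈ dssfStage G n, ∃ b ∈ G,
      p = (a.1 + (G.sup Prod.fst + 1) ^ (n + 1) * b.1,
           a.2 + (G.sup Prod.snd + 1) ^ (n + 1) * b.2)}

/-- The discrete self-similar fractal with generator `G`, as a subset of `ℤ²`. -/
def dssf (G : Finset (ℕ × ℕ)) : Set (ℤ × ℤ) :=
  (fun p : ℕ × ℕ => ((p.1 : ℤ), (p.2 : ℤ))) '' ⋃ n, dssfStage G n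

/-- The H fractal. -/
def hFractal : Set (ℤ × ℤ) :=
  dssf {(0, 0), (0, 1), (0, 2), (1, 1), (2, 0), (2, 1), (2, 2)}

/-! The generator is the 3 by 3 square without (1, 0) and (1, 2), so at a point of the H fractal
each ternary digit 1 of the first coordinate is matched by a digit 1 of the second. In the column
`ones k` this leaves only the isolated points `columnPoint k q`, at distance 3 ^ k. Growth passes to
the right through single tiles there, and just beyond the column the fractal splits into parts too
far apart to interact.

Suppose the fractal is finitely self-assembled. If single tiles of that column triggered only
boundedly wide growth to their right, all growth would be bounded (`fst_le_of_producible`). So for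
every large k some tile type with unbounded right growth occurs at a `columnPoint k q`, and all of
this growth, being repeatable there (`RightGrown.producible_overlay`), fits into the fractal. As
there are finitely many tile types, one type does this for infinitely many k.

This is impossible (`UnboundedRight.not_fits`). The growth fits at one `columnPoint l q` and, for
arbitrarily large m, at some `columnPoint m q'`; the latter forces the digit condition for balanced
ternary digits around the tile. Contracted by 3 ^ l, the growth becomes a connected subset of
`biFractal q` that meets column 0. By induction on the scale (`levelEnds_left`, `levelEnds_right`),
paths between the end columns of certain intervals join equal heights only. But heights are `ones n`
modulo 3 ^ n in column `ones n` and `q` modulo 3 ^ n in column 3 ^ n. For large even n these differ,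
so no path crosses (`exists_fst_lt_of_joined`). -/

/-! ### Ternary digits -/

/-- The number with `n` ternary digits, all equal to `1`. -/
def ones : ℕ → ℤ
  | 0 => 0
  | n + 1 => 3 * ones n + 1

theorem two_mul_ones (n : ℕ) : 2 * ones n + 1 = 3 ^ n := by
  induction n with
  | zero => simp [ones]
  | succ n ih => rw [ones, pow_succ]; linarith

theorem ones_succ' (n : ℕ) : ones (n + 1) = 3 ^ n + ones n := by
  have := two_mul_ones n
  rw [ones]; linarith

theorem ones_nonneg (n : ℕ) : 0 ≤ ones n := by
  have := two_mul_ones n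
  have : (1 : ℤ) ≤ 3 ^ n := one_le_pow₀ (by norm_num)
  linarith

theorem natCast_le_ones (n : ℕ) : (n : ℤ) ≤ ones n := by
  induction n with
  | zero => simp [ones]
  | succ n ih => have := ones_nonneg n; rw [ones]; push_cast; linarith

theorem ones_add (m n : ℕ) : ones (m + n) = ones m + 3 ^ m * ones n := by
  have h₁ := two_mul_ones m
  have h₂ := two_mul_ones n
  have h₃ := two_mul_ones (m + n)
  rw [pow_add, ← h₂] at h₃
  linarith

/-- The `i`-th ternary digits, `i < N`, of `v` are `1` wherever those of `x` are. -/
def OnesLE (N : ℕ) (x v : ℤ) : Prop := ∀ i < N, x / 3 ^ i % 3 = 1 → v / 3 ^ i % 3 = 1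

theorem add_pow_mul_ediv_emod {N i : ℕ} (hi : i < N) (x a : ℤ) :
    (x + 3 ^ N * a) / 3 ^ i % 3 = x / 3 ^ i % 3 := by
  obtain ⟨j, rfl⟩ := Nat.exists_eq_add_of_lt hi
  have : x + 3 ^ (i + j + 1) * a = x + 3 ^ i * (3 * (3 ^ j * a)) := by ring
  rw [this, Int.add_mul_ediv_left _ _ (by positivity), Int.add_mul_emod_self_left]

theorem OnesLE.of_add {N : ℕ} {x v : ℤ} (a b : ℤ)
    (h : OnesLE N (x + 3 ^ N * a) (v + 3 ^ N * b)) : OnesLE N x v := by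
  intro i hi
  have := h i hi
  rwa [add_pow_mul_ediv_emod hi, add_pow_mul_ediv_emod hi] at this

theorem OnesLE.ediv {N l : ℕ} {x v : ℤ} (h : OnesLE (l + N) x v) :
    OnesLE N (x / 3 ^ l) (v / 3 ^ l) := by
  intro i hi
  have := h (l + i) (by omega)
  rwa [pow_add, ← Int.ediv_ediv_of_nonneg (by positivity),
    ← Int.ediv_ediv_of_nonneg (by positivity)] at this

theorem ones_ediv_emod {N i : ℕ} (hi : i < N) : ones N / 3 ^ i % 3 = 1 := by
  obtain ⟨j, rfl⟩ := Nat.exists_eq_add_of_lt hi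
  have h₁ := two_mul_ones i
  have h₂ := ones_nonneg i
  rw [add_assoc, ones_add, Int.add_mul_ediv_left _ _ (by positivity),
    Int.ediv_eq_zero_of_lt h₂ (by linarith), ones]
  omega

theorem exists_eq_ones_add {N : ℕ} {v : ℤ} (h : ∀ i < N, v / 3 ^ i % 3 = 1) :
    ∃ q, v = ones N + 3 ^ N * q := by
  induction N with
  | zero => exact ⟨v, by simp [ones]⟩
  | succ N ih =>
    obtain ⟨q, hq⟩ := ih fun i hi => h i (hi.trans (Nat.lt_succ_self N))
    have h₁ := h N (Nat.lt_succ_self N)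
    have h₂ := two_mul_ones N
    rw [hq, Int.add_mul_ediv_left _ _ (by positivity),
      Int.ediv_eq_zero_of_lt (ones_nonneg N) (by have := ones_nonneg N; linarith)] at h₁
    obtain ⟨r, rfl⟩ : ∃ r, q = 3 * r + 1 := ⟨q / 3, by omega⟩
    refine ⟨r, ?_⟩
    rw [hq, ones_succ', pow_succ]
    ring

/-- If the last `N` digits of `x` are `1` and `OnesLE N x v`, then so are those of `v`. -/
theorem OnesLE.exists_eq {N : ℕ} {a v : ℤ} (h : OnesLE N (ones N + 3 ^ N * a) v) :
    ∃ q, v = ones N + 3 ^ N * q :=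
  exists_eq_ones_add fun i hi => h i hi (by rw [add_pow_mul_ediv_emod hi, ones_ediv_emod hi])

theorem ediv_pow_eq_of_mem {N : ℕ} {x a : ℤ} (h₁ : 3 ^ N * a ≤ x) (h₂ : x < 3 ^ N * (a + 1)) :
    x / 3 ^ N = a := by
  have h₀ : (0 : ℤ) < 3 ^ N := by positivity
  apply le_antisymm
  · exact Int.lt_add_one_iff.1 (Int.ediv_lt_of_lt_mul h₀ (by linarith))
  · exact Int.le_ediv_of_mul_le h₀ (by linarith)

/-- If digit `N` of `x` is `1`, then `v` lies in the middle third of a block of length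
`3 ^ (N + 1)`. -/
theorem OnesLE.exists_abs_sub_le {N : ℕ} {x v : ℤ} (a : ℤ) (h : OnesLE (N + 1) x v)
    (h₁ : 3 ^ N * (3 * a + 1) ≤ x) (h₂ : x < 3 ^ N * (3 * a + 2)) :
    ∃ k, |v - (ones (N + 1) + 3 * 3 ^ N * k)| ≤ ones N := by
  have h₃ := h N (Nat.lt_succ_self N) (by
    rw [ediv_pow_eq_of_mem h₁ (by linarith)]; omega)
  have h₄ := two_mul_ones N
  obtain ⟨r, hr⟩ : ∃ r, v / 3 ^ N = 3 * r + 1 := ⟨v / 3 ^ N / 3, by omega⟩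
  refine ⟨r, ?_⟩
  have h₅ := Int.emod_add_mul_ediv v (3 ^ N)
  have h₆ := Int.emod_nonneg v (b := 3 ^ N) (by positivity)
  have h₇ := Int.emod_lt_of_pos v (b := 3 ^ N) (by positivity)
  rw [hr] at h₅
  rw [ones_succ', abs_le]
  constructor <;> linarith

/-! ### The H fractal -/

/-- The generator of the H fractal. -/
abbrev hGenerator : Finset (ℕ × ℕ) := {(0, 0), (0, 1), (0, 2), (1, 1), (2, 0), (2, 1), (2, 2)}

theorem hGenerator_sup_fst : hGenerator.sup Prod.fst + 1 = 3 := by decide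

theorem hGenerator_sup_snd : hGenerator.sup Prod.snd + 1 = 3 := by decide

theorem of_mem_hGenerator {b : ℕ × ℕ} (hb : b ∈ hGenerator) :
    b.1 < 3 ∧ b.2 < 3 ∧ (b.1 = 1 → b.2 = 1) := by
  revert b; decide

theorem nat_div_mod_add {n i a b : ℕ} (ha : a < 3 ^ n) (hb : b < 3) :
    (a + 3 ^ n * b) / 3 ^ i % 3 = if i < n then a / 3 ^ i % 3 else if i = n then b else 0 := by
  split_ifs with h₁ h₂
  · obtain ⟨j, rfl⟩ := Nat.exists_eq_add_of_lt h₁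
    have : a + 3 ^ (i + j + 1) * b = a + 3 ^ i * (3 * (3 ^ j * b)) := by ring
    rw [this, Nat.add_mul_div_left _ _ (by positivity), Nat.add_mul_mod_self_left]
  · subst h₂
    rw [Nat.add_mul_div_left _ _ (by positivity), Nat.div_eq_of_lt ha]
    omega
  · obtain ⟨j, rfl⟩ := Nat.exists_eq_add_of_lt (show n < i by omega)
    rw [Nat.div_eq_of_lt]
    calc a + 3 ^ n * b < 3 ^ n + 3 ^ n * b := by omega
      _ = 3 ^ n * (b + 1) := by ring
      _ ≤ 3 ^ n * 3 := Nat.mul_le_mul_left _ hb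
      _ = 3 ^ (n + 1) := by ring
      _ ≤ 3 ^ (n + j + 1) := Nat.pow_le_pow_right (by norm_num) (by omega)

/-- Each new stage prepends a pair of leading digits taken from the generator, so the condition is
inherited. Its converse is not needed. -/
theorem of_mem_dssfStage {n : ℕ} {p : ℕ × ℕ} (hp : p ∈ dssfStage hGenerator n) :
    p.1 < 3 ^ (n + 1) ∧ p.2 < 3 ^ (n + 1) ∧ ∀ i, p.1 / 3 ^ i % 3 = 1 → p.2 / 3 ^ i % 3 = 1 := by
  induction n generalizing p with
  | zero =>
    obtain ⟨h₁, h₂, h₃⟩ := of_mem_hGenerator hp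
    refine ⟨by simpa using h₁, by simpa using h₂, fun i => ?_⟩
    have e₁ := nat_div_mod_add (n := 0) (i := i) (a := 0) (by norm_num) h₁
    have e₂ := nat_div_mod_add (n := 0) (i := i) (a := 0) (by norm_num) h₂
    simp only [pow_zero, one_mul, zero_add, Nat.not_lt_zero, if_false] at e₁ e₂
    rw [e₁, e₂]
    split_ifs
    · exact h₃
    · exact id
  | succ n ih =>
    obtain ⟨a, ha, b, hb, rfl⟩ := hp
    obtain ⟨h₁, h₂, h₃⟩ := of_mem_hGenerator hb
    obtain ⟨h₄, h₅, h₆⟩ := ih ha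
    simp only [hGenerator_sup_fst, hGenerator_sup_snd]
    refine ⟨?_, ?_, fun i => ?_⟩
    · rw [pow_succ 3 (n + 1)]; nlinarith
    · rw [pow_succ 3 (n + 1)]; nlinarith
    · rw [nat_div_mod_add h₄ h₁, nat_div_mod_add h₅ h₂]
      split_ifs
      · exact h₆ i
      · exact h₃
      · exact id

theorem nonneg_of_mem_hFractal {p : ℤ × ℤ} (hp : p ∈ hFractal) : 0 ≤ p.1 ∧ 0 ≤ p.2 := by
  obtain ⟨p, -, rfl⟩ := hp
  exact ⟨Int.natCast_nonneg _, Int.natCast_nonneg _⟩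

theorem onesLE_of_mem_hFractal {p : ℤ × ℤ} (hp : p ∈ hFractal) (N : ℕ) : OnesLE N p.1 p.2 := by
  obtain ⟨p, hp, rfl⟩ := hp
  obtain ⟨n, hn⟩ := Set.mem_iUnion.1 hp
  intro i _ h
  dsimp only at h ⊢
  exact_mod_cast (of_mem_dssfStage hn).2.2 i (by exact_mod_cast h)

theorem zero_mem_dssfStage (n : ℕ) : (0, 0) ∈ dssfStage hGenerator n := by
  induction n with
  | zero => show (0, 0) ∈ hGenerator; decide
  | succ n ih => exact ⟨(0, 0), ih, (0, 0), by decide, by simp⟩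

theorem exists_mem_hFractal_lt (b : ℤ) : ∃ p ∈ hFractal, b < p.1 := by
  refine ⟨(((3 ^ (b.toNat + 1) * 2 : ℕ) : ℤ), ((0 : ℕ) : ℤ)), ⟨(3 ^ (b.toNat + 1) * 2, 0),
    Set.mem_iUnion.2 ⟨b.toNat + 1, (0, 0), zero_mem_dssfStage _, (2, 0), by decide, ?_⟩, rfl⟩, ?_⟩
  · simp only [hGenerator_sup_fst]; simp
  · have : b.toNat + 1 < 3 ^ (b.toNat + 1) := Nat.lt_pow_self (by norm_num)
    simp only
    omega

/-! ### Paths in subsets of the lattice -/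

/-- Two points coincide or are neighbours in the lattice. -/
def Near (p p' : ℤ × ℤ) : Prop :=
  p.1 = p'.1 ∧ |p'.2 - p.2| ≤ 1 ∨ p.2 = p'.2 ∧ |p'.1 - p.1| ≤ 1

/-- There is a lattice path from one point to the other inside `W`. -/
def LatticeJoined (W : Set (ℤ × ℤ)) : ℤ × ℤ → ℤ × ℤ → Prop :=
  Relation.ReflTransGen fun p p' => Near p p' ∧ p ∈ W ∧ p' ∈ W

theorem LatticeJoined.mono {W W' : Set (ℤ × ℤ)} (h : W ⊆ W') {p p' : ℤ × ℤ} (hp : LatticeJoined W p p') :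
    LatticeJoined W' p p' :=
  Relation.ReflTransGen.mono (fun _ _ h' => ⟨h'.1, h h'.2.1, h h'.2.2⟩) _ _ hp

/-- A path from a column `≤ lo` to a column `≥ hi` contains a crossing of the columns between. -/
theorem exists_crossing {Z : Set (ℤ × ℤ)} {lo hi : ℤ} (h : lo ≤ hi) {p₀ p : ℤ × ℤ}
    (hp₀ : p₀ ∈ Z) (hj : LatticeJoined Z p₀ p) (h₀ : p₀.1 ≤ lo) (h₁ : hi ≤ p.1) :
    ∃ e e', e ∈ Z ∧ e' ∈ Z ∧ e.1 = lo ∧ e'.1 = hi ∧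
      LatticeJoined (Z ∩ {p | lo ≤ p.1 ∧ p.1 ≤ hi}) e e' := by
  by_contra hcon
  -- The invariant remembers a visit to column `lo` since which the path has stayed in the strip;
  -- leaving the strip beyond `hi` would complete a crossing.
  suffices H : p ∈ Z ∧ (p.1 < lo ∨ ∃ e ∈ Z, e.1 = lo ∧ (lo ≤ p.1 ∧ p.1 ≤ hi) ∧
      LatticeJoined (Z ∩ {p | lo ≤ p.1 ∧ p.1 ≤ hi}) e p) by
    obtain ⟨hp, H | ⟨e, he, he', h₃, h₄⟩⟩ := H
    · omega
    · exact hcon ⟨e, p, he, hp, he', by omega, h₄⟩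
  clear h₁
  induction hj with
  | refl =>
    rcases h₀.lt_or_eq with h₀ | h₀
    · exact ⟨hp₀, .inl h₀⟩
    · exact ⟨hp₀, .inr ⟨p₀, hp₀, h₀, ⟨by omega, by omega⟩, .refl⟩⟩
  | @tail p p' _ hs ih =>
    obtain ⟨hn, hp, hp'⟩ := hs
    refine ⟨hp', ?_⟩
    have hstep : |p'.1 - p.1| ≤ 1 := by
      rcases hn with hn | hn
      · rw [hn.1]; simp
      · exact hn.2
    rw [abs_le] at hstep
    by_cases hlo : p'.1 < lo
    · exact .inl hlo
    right
    obtain ⟨-, ih | ⟨e, he, he', h₃, h₄⟩⟩ := ih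
    · exact ⟨p', hp', by omega, ⟨by omega, by omega⟩, .refl⟩
    · by_cases hhi : p'.1 ≤ hi
      · exact ⟨e, he, he', ⟨by omega, hhi⟩, h₄.tail ⟨hn, ⟨hp, h₃⟩, hp', by omega, hhi⟩⟩
      · exact absurd ⟨e, p, he, hp, he', by omega, h₄⟩ hcon

theorem Near.abs_fst {p p' : ℤ × ℤ} (h : Near p p') : |p.1 - p'.1| ≤ 1 := by
  rcases h with h | h
  · rw [h.1]; simp
  · rw [abs_sub_comm]; exact h.2

theorem Near.abs_snd {p p' : ℤ × ℤ} (h : Near p p') : |p'.2 - p.2| ≤ 1 := by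
  rcases h with h | h
  · exact h.2
  · rw [h.1]; simp

theorem Near.snd_eq {p p' : ℤ × ℤ} (h : Near p p') (hne : p.1 ≠ p'.1) : p.2 = p'.2 := by
  rcases h with h | h
  · exact absurd h.1 hne
  · exact h.1

theorem eq_of_mul_sub_lt {D k k' : ℤ} (h₁ : D * (k - k') < D) (h₂ : -D < D * (k - k')) :
    k = k' := by
  have hD : 0 < D := by linarith
  have h₃ : k - k' < 1 := by by_contra h; nlinarith
  have h₄ : -1 < k - k' := by by_contra h; nlinarith
  omega

/-- Columns `M` between columns `A` and columns `B`. Near `A`, points are confined to blocks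
centred at the numbers `a` modulo `3 * D`, and near `B` to blocks centred at `b` modulo `3 * D`.
If paths in the columns `M` join only end points of equal height, then so do paths in the
union of the three sets of columns. -/
theorem snd_eq_of_joined {Z : Set (ℤ × ℤ)} {A B M : Set ℤ} {mA mB D c a b : ℤ}
    (hc : 0 ≤ c) (hD : D = 2 * c + 1)
    (hA : ∀ p ∈ Z, p.1 ∈ A → ∃ k, |p.2 - (a + 3 * D * k)| ≤ c)
    (hB : ∀ p ∈ Z, p.1 ∈ B → ∃ k, |p.2 - (b + 3 * D * k)| ≤ c)
    (hAB : ∀ x ∈ A, ∀ y ∈ B, 1 < |x - y|)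
    (hAM : ∀ x ∈ A, ∀ y ∈ M, x ≠ y ∧ (|x - y| ≤ 1 → y = mA))
    (hBM : ∀ x ∈ B, ∀ y ∈ M, x ≠ y ∧ (|x - y| ≤ 1 → y = mB))
    (hmA : ∀ p ∈ Z, p.1 = mA → ∃ k, p.2 = b + D * k)
    (hmB : ∀ p ∈ Z, p.1 = mB → ∃ k, p.2 = a + D * k)
    (hM : ∀ p ∈ Z, ∀ p' ∈ Z, LatticeJoined (Z ∩ {p | p.1 ∈ M}) p p' →
      (p.1 = mA ∨ p.1 = mB) → (p'.1 = mA ∨ p'.1 = mB) → p.2 = p'.2)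
    {p₀ p : ℤ × ℤ}
    (hp₀ : (p₀.1 ∈ A ∧ ∃ k, p₀.2 = a + 3 * D * k) ∨ (p₀.1 ∈ B ∧ ∃ k, p₀.2 = b + 3 * D * k))
    (hp : (p.1 ∈ A ∧ ∃ k, p.2 = a + 3 * D * k) ∨ (p.1 ∈ B ∧ ∃ k, p.2 = b + 3 * D * k))
    (hj : LatticeJoined (Z ∩ {p | p.1 ∈ A ∪ M ∪ B}) p₀ p) : p₀.2 = p.2 := by
  have hD' : 2 * c + 1 ≤ D := hD.ge
  -- Invariant along the path: in `A` and `B` the height stays within `c` of the initial one, as the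
  -- gaps between blocks are too wide for one step; in `M` the entry point `e` is remembered.
  suffices H : (p.1 ∈ A ∧ (∃ k, p₀.2 = a + 3 * D * k) ∧ |p.2 - p₀.2| ≤ c) ∨
      (p.1 ∈ B ∧ (∃ k, p₀.2 = b + 3 * D * k) ∧ |p.2 - p₀.2| ≤ c) ∨
      (p.1 ∈ M ∧ ∃ e ∈ Z, |e.2 - p₀.2| ≤ c ∧ LatticeJoined (Z ∩ {p | p.1 ∈ M}) e p ∧
        ((e.1 = mA ∧ ∃ k, p₀.2 = a + 3 * D * k) ∨ (e.1 = mB ∧ ∃ k, p₀.2 = b + 3 * D * k))) by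
    rcases H with ⟨h₁, ⟨k, hk⟩, h₂⟩ | ⟨h₁, ⟨k, hk⟩, h₂⟩ | ⟨h₁, -⟩ <;>
      rcases hp with ⟨h₃, k', hk'⟩ | ⟨h₃, k', hk'⟩
    · rw [abs_le] at h₂
      rw [hk, hk', eq_of_mul_sub_lt (D := 3 * D) (k := k) (k' := k') (by linarith) (by linarith)]
    · simpa using hAB _ h₁ _ h₃
    · simpa using hAB _ h₃ _ h₁
    · rw [abs_le] at h₂
      rw [hk, hk', eq_of_mul_sub_lt (D := 3 * D) (k := k) (k' := k') (by linarith) (by linarith)]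
    · exact absurd rfl (hAM _ h₃ _ h₁).1
    · exact absurd rfl (hBM _ h₃ _ h₁).1
  clear hp
  induction hj with
  | refl =>
    rcases hp₀ with hp₀ | hp₀
    · exact .inl ⟨hp₀.1, hp₀.2, by simpa using hc⟩
    · exact .inr (.inl ⟨hp₀.1, hp₀.2, by simpa using hc⟩)
  | @tail p p' _ hs ih =>
    obtain ⟨hn, ⟨hpZ, -⟩, hpZ', (hA' | hM') | hB'⟩ := hs
    · left
      obtain ⟨k', hk'⟩ := hA p' hpZ' hA'
      rcases ih with ⟨h₁, ⟨k, hk⟩, h₂⟩ | ⟨h₁, -⟩ | ⟨h₁, e, heZ, h₂, he, h₃⟩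
      · refine ⟨hA', ⟨k, hk⟩, ?_⟩
        have := hn.abs_snd
        rw [abs_le] at this h₂ hk'
        have := eq_of_mul_sub_lt (D := 3 * D) (k := k) (k' := k') (by linarith) (by linarith)
        subst this
        rw [abs_le]
        constructor <;> linarith
      · have := hAB _ hA' _ h₁
        have := hn.abs_fst
        rw [abs_sub_comm] at this
        linarith
      · obtain ⟨h₄, h₅⟩ := hAM _ hA' _ h₁
        have h₅ := h₅ (by rw [abs_sub_comm]; exact hn.abs_fst)
        have h₆ := hn.snd_eq h₄.symm
        have h₇ := hM e heZ p hpZ he (h₃.imp And.left And.left) (.inl h₅)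
        rcases h₃ with ⟨h₃, hk⟩ | ⟨h₃, k, hk⟩
        · exact ⟨hA', hk, by rw [← h₆, ← h₇]; exact h₂⟩
        -- A passage from `B` to `A`: the common height of `e` and `p` is `a` as well as `b` modulo
        -- `D`, and within `c < D` of a block centre of each kind. Hence it equals both centres, one
        -- of which is `p₀.2`.
        · obtain ⟨i, hi⟩ := hmB e heZ h₃
          obtain ⟨j, hj⟩ := hmA p hpZ h₅
          rw [abs_le] at h₂ hk'
          have e₁ := eq_of_mul_sub_lt (D := D) (k := j) (k' := 3 * k)
            (by linarith) (by linarith)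
          have e₂ := eq_of_mul_sub_lt (D := D) (k := i) (k' := 3 * k')
            (by linarith) (by linarith)
          refine ⟨hA', ⟨k', ?_⟩, ?_⟩
          · subst e₁ e₂; linarith
          · rw [abs_le]; constructor <;> linarith
    · right; right
      refine ⟨hM', ?_⟩
      rcases ih with ⟨h₁, hk, h₂⟩ | ⟨h₁, hk, h₂⟩ | ⟨h₁, e, heZ, h₂, he, h₃⟩
      · obtain ⟨h₄, h₅⟩ := hAM _ h₁ _ hM'
        exact ⟨p', hpZ', by rw [← hn.snd_eq h₄]; exact h₂, .refl, .inl ⟨h₅ hn.abs_fst, hk⟩⟩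
      · obtain ⟨h₄, h₅⟩ := hBM _ h₁ _ hM'
        exact ⟨p', hpZ', by rw [← hn.snd_eq h₄]; exact h₂, .refl, .inr ⟨h₅ hn.abs_fst, hk⟩⟩
      · exact ⟨e, heZ, h₂, he.tail ⟨hn, ⟨hpZ, h₁⟩, hpZ', hM'⟩, h₃⟩
    · right; left
      obtain ⟨k', hk'⟩ := hB p' hpZ' hB'
      rcases ih with ⟨h₁, -⟩ | ⟨h₁, ⟨k, hk⟩, h₂⟩ | ⟨h₁, e, heZ, h₂, he, h₃⟩
      · have := hAB _ h₁ _ hB'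
        have := hn.abs_fst
        linarith
      · refine ⟨hB', ⟨k, hk⟩, ?_⟩
        have := hn.abs_snd
        rw [abs_le] at this h₂ hk'
        have := eq_of_mul_sub_lt (D := 3 * D) (k := k) (k' := k') (by linarith) (by linarith)
        subst this
        rw [abs_le]
        constructor <;> linarith
      · obtain ⟨h₄, h₅⟩ := hBM _ hB' _ h₁
        have h₅ := h₅ (by rw [abs_sub_comm]; exact hn.abs_fst)
        have h₆ := hn.snd_eq h₄.symm
        have h₇ := hM e heZ p hpZ he (h₃.imp And.left And.left) (.inr h₅)
        rcases h₃ with ⟨h₃, k, hk⟩ | ⟨h₃, hk⟩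
        · obtain ⟨i, hi⟩ := hmA e heZ h₃
          obtain ⟨j, hj⟩ := hmB p hpZ h₅
          rw [abs_le] at h₂ hk'
          have e₁ := eq_of_mul_sub_lt (D := D) (k := j) (k' := 3 * k)
            (by linarith) (by linarith)
          have e₂ := eq_of_mul_sub_lt (D := D) (k := i) (k' := 3 * k')
            (by linarith) (by linarith)
          refine ⟨hB', ⟨k', ?_⟩, ?_⟩
          · subst e₁ e₂; linarith
          · rw [abs_le]; constructor <;> linarith
        · exact ⟨hB', hk, by rw [← h₆, ← h₇]; exact h₂⟩

/-! ### Paths in the intersection of two H fractals -/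

/-- The points of the plane that satisfy the ternary digit condition of the H fractal and, after a
vertical translation by `-q`, the balanced ternary digit condition of the H fractal that extends
in all directions. -/
def biFractal (q : ℤ) : Set (ℤ × ℤ) :=
  {p | ∀ N, OnesLE N p.1 p.2 ∧ OnesLE N (p.1 + ones N) (p.2 - q + ones N)}

theorem exists_eq_of_fst_eq_ones {q : ℤ} {p : ℤ × ℤ} (hp : p ∈ biFractal q) (N : ℕ) (a : ℤ)
    (h : p.1 = ones N + 3 ^ N * a) : ∃ k, p.2 = ones N + 3 ^ N * k := by
  have := (hp N).1
  rw [h] at this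
  exact this.exists_eq

/-- Adding `ones N` to a multiple of 3 ^ N makes the last `N` digits 1. -/
theorem exists_eq_of_fst_eq_mul {q : ℤ} {p : ℤ × ℤ} (hp : p ∈ biFractal q) (N : ℕ) (a : ℤ)
    (h : p.1 = 3 ^ N * a) : ∃ k, p.2 = q + 3 ^ N * k := by
  have := (hp N).2
  rw [h, add_comm] at this
  obtain ⟨k, hk⟩ := this.exists_eq
  exact ⟨k, by linarith⟩

theorem abs_sub_le_of_fst_mem {q : ℤ} {p : ℤ × ℤ} (hp : p ∈ biFractal q) (N : ℕ) (a : ℤ)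
    (h₁ : 3 ^ N * (3 * a + 1) ≤ p.1) (h₂ : p.1 < 3 ^ N * (3 * a + 2)) :
    ∃ k, |p.2 - (ones (N + 1) + 3 * 3 ^ N * k)| ≤ ones N :=
  (hp (N + 1)).1.exists_abs_sub_le a h₁ h₂

theorem abs_sub_le_of_fst_mem' {q : ℤ} {p : ℤ × ℤ} (hp : p ∈ biFractal q) (N : ℕ) (a : ℤ)
    (h : |p.1 - 3 * 3 ^ N * a| ≤ ones N) :
    ∃ k, |p.2 - (q + 3 * 3 ^ N * k)| ≤ ones N := by
  rw [abs_le] at h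
  have h₀ := ones_succ' N
  have h₃ := two_mul_ones N
  obtain ⟨k, hk⟩ := (hp (N + 1)).2.exists_abs_sub_le a (by linarith) (by linarith)
  refine ⟨k, ?_⟩
  convert hk using 2
  ring

/-- Lattice paths in the columns of an interval join only end points of equal height. -/
def LevelEnds (q lo hi : ℤ) : Prop :=
  ∀ p ∈ biFractal q, ∀ p' ∈ biFractal q,
    LatticeJoined (biFractal q ∩ {p | lo ≤ p.1 ∧ p.1 ≤ hi}) p p' →
    (p.1 = lo ∨ p.1 = hi) → (p'.1 = lo ∨ p'.1 = hi) → p.2 = p'.2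

/-- The balanced condition fixes heights modulo 3 in column `3 * a`, the ordinary one in column `3 *
a + 1`, so vertical steps are impossible. -/
theorem levelEnds_one (q a : ℤ) : LevelEnds q (3 ^ 1 * a) (3 ^ 1 * a + ones 1) := by
  intro p hp p' hp' hj _ _
  have e : ones 1 = 1 := rfl
  induction hj with
  | refl => rfl
  | @tail r r' _ hs ih =>
    obtain ⟨hn, ⟨hr, hr₁, hr₂⟩, hr', hr₁', hr₂'⟩ := hs
    rw [ih hr ?_]
    · by_contra hne
      have h₁ : r.1 = r'.1 := by by_contra h; exact hne (hn.snd_eq h)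
      have h₂ := hn.abs_snd
      rw [abs_le] at h₂
      rcases (by omega : r.1 = 3 ^ 1 * a ∨ r.1 = ones 1 + 3 ^ 1 * a) with h | h
      · obtain ⟨k, hk⟩ := exists_eq_of_fst_eq_mul hr 1 a h
        obtain ⟨k', hk'⟩ := exists_eq_of_fst_eq_mul hr' 1 a (h₁ ▸ h)
        omega
      · obtain ⟨k, hk⟩ := exists_eq_of_fst_eq_ones hr 1 a h
        obtain ⟨k', hk'⟩ := exists_eq_of_fst_eq_ones hr' 1 a (h₁ ▸ h)
        omega
    · omega

/-- In `A` digit `N` of the column is 1, which keeps heights near `ones (N + 1)` modulo 3 ^ (N + 1).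
`B` is close to a multiple of 3 ^ (N + 1), where the balanced condition keeps them near `q`. Between
them `M` is an interval of the smaller scale. -/
theorem levelEnds_right {q : ℤ} {N : ℕ} (hN : 1 ≤ N)
    (h : ∀ a, LevelEnds q (3 ^ N * a) (3 ^ N * a + ones N)) (a : ℤ) :
    LevelEnds q (3 ^ (N + 1) * a + ones (N + 1)) (3 ^ (N + 1) * (a + 1)) := by
  intro p hp p' hp' hj h₁ h₂
  have e₁ := two_mul_ones N
  have e₂ := ones_succ' N
  have e₃ : (1 : ℤ) ≤ ones N := le_trans (by exact_mod_cast hN) (natCast_le_ones N)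
  have e₄ : (3 : ℤ) ^ (N + 1) * a = 3 * (3 ^ N * a) := by ring
  have e₅ : (3 : ℤ) ^ (N + 1) * (a + 1) = 3 * (3 ^ N * a) + 3 * 3 ^ N := by ring
  have ends : ∀ r ∈ biFractal q,
      (r.1 = 3 ^ (N + 1) * a + ones (N + 1) ∨ r.1 = 3 ^ (N + 1) * (a + 1)) →
      (r.1 ∈ Set.Icc (3 * (3 ^ N * a) + ones (N + 1)) (3 * (3 ^ N * a) + 2 * 3 ^ N - 1) ∧
        ∃ k, r.2 = ones (N + 1) + 3 * 3 ^ N * k) ∨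
      (r.1 ∈ Set.Icc (3 * (3 ^ N * a) + 2 * 3 ^ N + ones N + 1)
        (3 * (3 ^ N * a) + 3 * 3 ^ N) ∧ ∃ k, r.2 = q + 3 * 3 ^ N * k) := by
    intro r hr h
    rcases h with h | h
    · refine .inl ⟨⟨by linarith, by linarith⟩, ?_⟩
      obtain ⟨k, hk⟩ := exists_eq_of_fst_eq_ones hr (N + 1) a (by linarith)
      exact ⟨k, by rw [hk]; ring⟩
    · refine .inr ⟨⟨by linarith, by linarith⟩, ?_⟩
      obtain ⟨k, hk⟩ := exists_eq_of_fst_eq_mul hr (N + 1) (a + 1) h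
      exact ⟨k, by rw [hk]; ring⟩
  refine snd_eq_of_joined (Z := biFractal q)
    (A := Set.Icc (3 * (3 ^ N * a) + ones (N + 1)) (3 * (3 ^ N * a) + 2 * 3 ^ N - 1))
    (M := Set.Icc (3 * (3 ^ N * a) + 2 * 3 ^ N) (3 * (3 ^ N * a) + 2 * 3 ^ N + ones N))
    (B := Set.Icc (3 * (3 ^ N * a) + 2 * 3 ^ N + ones N + 1) (3 * (3 ^ N * a) + 3 * 3 ^ N))
    (mA := 3 * (3 ^ N * a) + 2 * 3 ^ N) (mB := 3 * (3 ^ N * a) + 2 * 3 ^ N + ones N)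
    (D := 3 ^ N) (c := ones N) (a := ones (N + 1)) (b := q) (by linarith) e₁.symm
    ?_ ?_ ?_ ?_ ?_ ?_ ?_ ?_ (ends p hp h₁) (ends p' hp' h₂) (hj.mono ?_)
  · rintro r hr ⟨h₃, h₄⟩
    exact abs_sub_le_of_fst_mem hr N a (by linarith) (by linarith)
  · rintro r hr ⟨h₃, h₄⟩
    exact abs_sub_le_of_fst_mem' hr N (a + 1) (by rw [abs_le]; constructor <;> linarith)
  · rintro x ⟨_, _⟩ y ⟨_, _⟩
    rw [lt_abs]; right; linarith
  · rintro x ⟨_, _⟩ y ⟨_, _⟩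
    refine ⟨by omega, fun h => ?_⟩
    rw [abs_le] at h; omega
  · rintro x ⟨_, _⟩ y ⟨_, _⟩
    refine ⟨by omega, fun h => ?_⟩
    rw [abs_le] at h; omega
  · exact fun r hr h => exists_eq_of_fst_eq_mul hr N (3 * a + 2) (by rw [h]; ring)
  · intro r hr h
    obtain ⟨k, hk⟩ := exists_eq_of_fst_eq_ones hr N (3 * a + 2) (by rw [h]; ring)
    -- The shift of `k` accounts for `ones (N + 1) = 3 ^ N + ones N`.
    exact ⟨k - 1, by rw [hk, e₂]; ring⟩
  · intro r hr r' hr' hj h₃ h₄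
    refine h (3 * a + 2) r hr r' hr' ?_ ?_ ?_
    all_goals rw [show (3 : ℤ) ^ N * (3 * a + 2) = 3 * (3 ^ N * a) + 2 * 3 ^ N by ring]
    · exact hj
    · exact h₃
    · exact h₄
  · rintro r ⟨hr, h₃, h₄⟩
    refine ⟨hr, ?_⟩
    simp only [Set.mem_ofPred_eq, Set.mem_union, Set.mem_Icc]
    omega

/-- The mirror image, with `A` on the right. Each of the two lemmas produces the kind of interval
that the other one assumes. -/
theorem levelEnds_left {q : ℤ} {N : ℕ} (hN : 1 ≤ N)
    (h : ∀ a, LevelEnds q (3 ^ N * a + ones N) (3 ^ N * (a + 1))) (a : ℤ) :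
    LevelEnds q (3 ^ (N + 1) * a) (3 ^ (N + 1) * a + ones (N + 1)) := by
  intro p hp p' hp' hj h₁ h₂
  have e₁ := two_mul_ones N
  have e₂ := ones_succ' N
  have e₃ : (1 : ℤ) ≤ ones N := le_trans (by exact_mod_cast hN) (natCast_le_ones N)
  have e₄ : (3 : ℤ) ^ (N + 1) * a = 3 * (3 ^ N * a) := by ring
  have ends : ∀ r ∈ biFractal q,
      (r.1 = 3 ^ (N + 1) * a ∨ r.1 = 3 ^ (N + 1) * a + ones (N + 1)) →
      (r.1 ∈ Set.Icc (3 * (3 ^ N * a) + 3 ^ N + 1) (3 * (3 ^ N * a) + ones (N + 1)) ∧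
        ∃ k, r.2 = ones (N + 1) + 3 * 3 ^ N * k) ∨
      (r.1 ∈ Set.Icc (3 * (3 ^ N * a)) (3 * (3 ^ N * a) + ones N - 1) ∧
        ∃ k, r.2 = q + 3 * 3 ^ N * k) := by
    intro r hr h
    rcases h with h | h
    · refine .inr ⟨⟨by linarith, by linarith⟩, ?_⟩
      obtain ⟨k, hk⟩ := exists_eq_of_fst_eq_mul hr (N + 1) a h
      exact ⟨k, by rw [hk]; ring⟩
    · refine .inl ⟨⟨by linarith, by linarith⟩, ?_⟩
      obtain ⟨k, hk⟩ := exists_eq_of_fst_eq_ones hr (N + 1) a (by linarith)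
      exact ⟨k, by rw [hk]; ring⟩
  refine snd_eq_of_joined (Z := biFractal q)
    (A := Set.Icc (3 * (3 ^ N * a) + 3 ^ N + 1) (3 * (3 ^ N * a) + ones (N + 1)))
    (M := Set.Icc (3 * (3 ^ N * a) + ones N) (3 * (3 ^ N * a) + 3 ^ N))
    (B := Set.Icc (3 * (3 ^ N * a)) (3 * (3 ^ N * a) + ones N - 1))
    (mA := 3 * (3 ^ N * a) + 3 ^ N) (mB := 3 * (3 ^ N * a) + ones N)
    (D := 3 ^ N) (c := ones N) (a := ones (N + 1)) (b := q) (by linarith) e₁.symm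
    ?_ ?_ ?_ ?_ ?_ ?_ ?_ ?_ (ends p hp h₁) (ends p' hp' h₂) (hj.mono ?_)
  · rintro r hr ⟨h₃, h₄⟩
    exact abs_sub_le_of_fst_mem hr N a (by linarith) (by linarith)
  · rintro r hr ⟨h₃, h₄⟩
    exact abs_sub_le_of_fst_mem' hr N a (by rw [abs_le]; constructor <;> linarith)
  · rintro x ⟨_, _⟩ y ⟨_, _⟩
    rw [lt_abs]; left; linarith
  · rintro x ⟨_, _⟩ y ⟨_, _⟩
    refine ⟨by omega, fun h => ?_⟩
    rw [abs_le] at h; omega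
  · rintro x ⟨_, _⟩ y ⟨_, _⟩
    refine ⟨by omega, fun h => ?_⟩
    rw [abs_le] at h; omega
  · exact fun r hr h => exists_eq_of_fst_eq_mul hr N (3 * a + 1) (by rw [h]; ring)
  · intro r hr h
    obtain ⟨k, hk⟩ := exists_eq_of_fst_eq_ones hr N (3 * a) (by rw [h]; ring)
    exact ⟨k - 1, by rw [hk, e₂]; ring⟩
  · intro r hr r' hr' hj h₃ h₄
    refine h (3 * a) r hr r' hr' ?_ ?_ ?_
    all_goals rw [show (3 : ℤ) ^ N * (3 * a) = 3 * (3 ^ N * a) by ring,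
      show (3 : ℤ) ^ N * (3 * a + 1) = 3 * (3 ^ N * a) + 3 ^ N by ring]
    · exact hj
    · exact h₃.symm
    · exact h₄.symm
  · rintro r ⟨hr, h₃, h₄⟩
    refine ⟨hr, ?_⟩
    simp only [Set.mem_ofPred_eq, Set.mem_union, Set.mem_Icc]
    omega

theorem levelEnds_even (q : ℤ) (m : ℕ) (a : ℤ) :
    LevelEnds q (3 ^ (2 * m + 2) * a + ones (2 * m + 2)) (3 ^ (2 * m + 2) * (a + 1)) := by
  induction m generalizing a with
  | zero => exact levelEnds_right le_rfl (levelEnds_one q) a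
  | succ m ih =>
    exact levelEnds_right (N := 2 * m + 3) (by omega) (levelEnds_left (by omega) ih) a

/-- Lattice paths that start in the column `0` of `biFractal q`, for `0 ≤ q`, do not reach
columns arbitrarily far to the right. -/
theorem exists_fst_lt_of_joined {q : ℤ} (hq : 0 ≤ q) :
    ∃ b, ∀ p₀ ∈ biFractal q, ∀ p, p₀.1 = 0 → LatticeJoined (biFractal q) p₀ p → p.1 < b := by
  have hm := natCast_le_ones (2 * q.toNat + 2)
  have e := two_mul_ones (2 * q.toNat + 2)
  -- The exponent is even, as `levelEnds_even` requires, and so large that `ones` of it exceeds `q +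
  -- 1`.
  refine ⟨3 ^ (2 * q.toNat + 2), fun p₀ hp₀ p h₀ hj => lt_of_not_ge fun hp => ?_⟩
  obtain ⟨e₁, e₂, he₁, he₂, h₁, h₂, hj'⟩ := exists_crossing
    (lo := ones (2 * q.toNat + 2)) (hi := 3 ^ (2 * q.toNat + 2))
    (by linarith [ones_nonneg (2 * q.toNat + 2)]) hp₀ hj
    (by rw [h₀]; exact ones_nonneg _) hp
  have h₃ := levelEnds_even q q.toNat 0 e₁ he₁ e₂ he₂ (by simpa using hj') (by simp [h₁])
    (by simp [h₂])
  obtain ⟨k₁, hk₁⟩ := exists_eq_of_fst_eq_ones he₁ (2 * q.toNat + 2) 0 (by rw [h₁]; ring)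
  obtain ⟨k₂, hk₂⟩ := exists_eq_of_fst_eq_mul he₂ (2 * q.toNat + 2) 1 (by rw [h₂]; ring)
  have hq' : q + 1 < ones (2 * q.toNat + 2) := by push_cast at hm; omega
  have := eq_of_mul_sub_lt (D := 3 ^ (2 * q.toNat + 2)) (k := k₂) (k' := k₁)
    (by linarith) (by linarith)
  subst this
  linarith

/-! ### Attachments -/

section attachStrength

variable {Glue : Type*} {strength : Glue → ℕ} {T : Finset (TileType Glue)}

theorem attachStrength_mono {α α' : Assembly T} {p p' : ℤ × ℤ} (t : T)
    (h : ∀ d : Side, α (p + d.vec) ≠ none → α' (p' + d.vec) = α (p + d.vec)) :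
    attachStrength strength α p t ≤ attachStrength strength α' p' t := by
  refine Finset.sum_le_sum fun d _ => ?_
  by_cases hd : α (p + d.vec) = none
  · rw [hd]; exact Nat.zero_le _
  · rw [h d hd]

theorem exists_ne_none_of_attachStrength_pos {α : Assembly T} {p : ℤ × ℤ} {t : T}
    (h : 0 < attachStrength strength α p t) : ∃ d : Side, α (p + d.vec) ≠ none := by
  by_contra! hcon
  refine h.ne' (Finset.sum_eq_zero fun d _ => ?_)
  rw [hcon d]; rfl

end attachStrength

theorem near_add_vec (p : ℤ × ℤ) (d : Side) : Near (p + d.vec) p := by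
  cases d <;> simp [Near, Side.vec]

theorem abs_vec_fst_le (d : Side) : |d.vec.1| ≤ 1 := by
  cases d <;> simp [Side.vec]

theorem abs_vec_snd_le (d : Side) : |d.vec.2| ≤ 1 := by
  cases d <;> simp [Side.vec]

theorem update_some_ne_none {Tile : Type*} {α : Assembly Tile} {p z : ℤ × ℤ} {u : Tile} :
    Function.update α p (some u) z ≠ none ↔ z = p ∨ α z ≠ none := by
  rw [Function.update_apply]
  split_ifs with h <;> simp [h]

/-! ### Growth to the right of a single tile -/

namespace TAS

variable {Glue : Type*} {𝒯 : TAS Glue}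

/-- The assemblies that grow from a single tile at the origin by attachments of tiles strictly to
the right of the origin. -/
inductive RightGrown (t : 𝒯.tiles) : Assembly 𝒯.tiles → Prop
  | base : RightGrown t (Function.update (fun _ => none) 0 (some t))
  | step {A : Assembly 𝒯.tiles} {p : ℤ × ℤ} {u : 𝒯.tiles} : RightGrown t A → 0 < p.1 →
      A p = none → 𝒯.temperature ≤ attachStrength 𝒯.strength A p u →
      RightGrown t (Function.update A p (some u))

namespace RightGrown

variable {t : 𝒯.tiles} {A : Assembly 𝒯.tiles}

theorem apply_zero (h : RightGrown t A) : A 0 = some t := by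
  induction h with
  | base => simp
  | @step A p u _ hp _ _ ih =>
    rw [Function.update_of_ne, ih]
    rintro rfl
    simp at hp

theorem eq_zero_or_pos (h : RightGrown t A) {z : ℤ × ℤ} (hz : A z ≠ none) : z = 0 ∨ 0 < z.1 := by
  induction h with
  | base => exact .inl (by simpa [update_some_ne_none] using hz)
  | step _ hp _ _ ih =>
    rcases update_some_ne_none.1 hz with rfl | hz
    · exact .inr hp
    · exact ih hz

theorem joined (h : RightGrown t A) (hτ : 0 < 𝒯.temperature) {z : ℤ × ℤ} (hz : A z ≠ none) :
    LatticeJoined A.dom 0 z := by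
  induction h generalizing z with
  | base =>
    obtain rfl : z = 0 := by simpa [update_some_ne_none] using hz
    exact .refl
  | @step A p u _ hp _ hs ih =>
    have hsub : A.dom ⊆ Assembly.dom (Function.update A p (some u)) := fun w hw =>
      update_some_ne_none.2 (.inr hw)
    rcases update_some_ne_none.1 hz with rfl | hz
    · obtain ⟨d, hd⟩ := exists_ne_none_of_attachStrength_pos (hτ.trans_le hs)
      exact ((ih hd).mono hsub).tail ⟨near_add_vec z d, hsub hd, update_some_ne_none.2 (.inl rfl)⟩
    · exact (ih hz).mono hsub

end RightGrown

theorem Producible.step {α β : Assembly 𝒯.tiles} (h : 𝒯.Producible α) (hs : 𝒯.Step α β) :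
    𝒯.Producible β :=
  Relation.ReflTransGen.tail h hs

theorem Producible.dom_finite {α : Assembly 𝒯.tiles} (h : 𝒯.Producible α) : α.dom.Finite := by
  induction h with
  | refl => exact 𝒯.seed_finite
  | @tail α β _ hs ih =>
    obtain ⟨p, t, -, -, rfl⟩ := hs
    exact (ih.insert p).subset fun z hz => update_some_ne_none.1 hz

theorem GrowsInto.dom_subset {α β : Assembly 𝒯.tiles} (h : 𝒯.GrowsInto α β) : α.dom ⊆ β.dom := by
  obtain ⟨s, rfl, -, hβ⟩ := h
  intro p hp
  obtain ⟨t, ht⟩ := Option.ne_none_iff_exists'.1 hp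
  show β p ≠ none
  rw [(hβ p t).2 ⟨0, ht⟩]
  simp

theorem FinitelySelfAssembles.dom_subset {X : Set (ℤ × ℤ)} (h : 𝒯.FinitelySelfAssembles X)
    {α : Assembly 𝒯.tiles} (hα : 𝒯.Producible α) : α.dom ⊆ X := by
  obtain ⟨β, hβ, rfl⟩ := h α hα hα.dom_finite
  exact hβ.dom_subset

/-- At temperature 0 any tile may be placed at any empty point, in particular outside `X`. -/
theorem FinitelySelfAssembles.temperature_pos {X : Set (ℤ × ℤ)}
    (h : 𝒯.FinitelySelfAssembles X) (hX : X.Nonempty) (hX' : X ≠ Set.univ) :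
    0 < 𝒯.temperature := by
  by_contra hτ
  obtain ⟨p, hp⟩ := (Set.ne_univ_iff_exists_notMem X).1 hX'
  obtain ⟨β, -, rfl⟩ := h 𝒯.seed .refl 𝒯.seed_finite
  obtain ⟨z, hz⟩ := hX
  obtain ⟨t, -⟩ := Option.ne_none_iff_exists'.1 hz
  have hseed : 𝒯.seed p = none := by
    by_contra hne
    exact hp (h.dom_subset .refl hne)
  have hprod : 𝒯.Producible (Function.update 𝒯.seed p (some t)) :=
    Producible.step .refl ⟨p, t, hseed, by omega, rfl⟩
  exact hp (h.dom_subset hprod (update_some_ne_none.2 (.inl rfl)))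

/-- Growth strictly to the right of a point can be repeated next to every producible assembly
that has no tiles to the right of this point. -/
theorem RightGrown.producible_overlay {t : 𝒯.tiles} {A α : Assembly 𝒯.tiles} {P : ℤ × ℤ}
    (h : RightGrown t A) (hα : 𝒯.Producible α) (hle : ∀ z, α z ≠ none → z.1 ≤ P.1)
    (hP : α P = some t) :
    𝒯.Producible fun z => if P.1 < z.1 then A (z - P) else α z := by
  induction h with
  | base =>
    convert hα using 1
    funext z
    split_ifs with hz
    · rw [Function.update_of_ne]
      · by_contra hne
        exact (hle z (Ne.symm hne)).not_gt hz
      · intro h0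
        rw [sub_eq_zero.1 h0] at hz
        exact lt_irrefl _ hz
    · rfl
  | @step A p u hA hp hnone hs ih =>
    -- The overlay offers every neighbour that `A` does, with `P` as the origin; further tiles of
    -- `α` can only add strength.
    refine ih.step ⟨p + P, u, ?_, hs.trans (attachStrength_mono u fun d hd => ?_), ?_⟩
    · simpa [hp] using hnone
    · have e : p + P + d.vec - P = p + d.vec := by abel
      rw [e]
      split_ifs with hlt
      · rfl
      · rcases hA.eq_zero_or_pos hd with h0 | h0
        · rw [h0, hA.apply_zero, ← hP]
          congr 1
          rw [← sub_eq_zero, ← h0]; abel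
        · exact absurd (by simp only [Prod.fst_add] at h0 ⊢; linarith) hlt
    · funext z
      simp only [Function.update_apply, sub_eq_iff_eq_add]
      split_ifs with h₁ h₂ h₃
      · rfl
      · rfl
      · rename_i h₃
        exact absurd (by rw [h₃]; simpa using hp) h₁
      · rfl

/-- The part of an assembly in the columns up to `c`. -/
def leftPart (c : ℤ) (α : Assembly 𝒯.tiles) : Assembly 𝒯.tiles :=
  fun z => if z.1 ≤ c then α z else none

end TAS

/-! ### Separate clusters to the right of a column -/

/-- The points of the H fractal in the column `ones k`. -/
def columnPoint (k : ℕ) (q : ℤ) : ℤ × ℤ := (ones k, ones k + 3 ^ k * q)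

/-- The point `columnPoint k q` and the points on the right of it in its block of height `3 ^ k`,
relative to `columnPoint k q`. -/
def rightBlock (k : ℕ) : Set (ℤ × ℤ) := {z | 0 ≤ z.1 ∧ |z.2| ≤ ones k}

open Classical in
/-- The part of an assembly in the right half of a block, moved to the origin. -/
noncomputable def TAS.cluster {Glue : Type*} {𝒯 : TAS Glue} (k : ℕ) (q : ℤ)
    (α : Assembly 𝒯.tiles) : Assembly 𝒯.tiles :=
  fun z => if z ∈ rightBlock k then α (z + columnPoint k q) else none

theorem eq_columnPoint_of_mem {k : ℕ} {p : ℤ × ℤ} (hp : p ∈ hFractal) (h : p.1 = ones k) :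
    ∃ q, p = columnPoint k q := by
  have := onesLE_of_mem_hFractal hp k
  rw [h, show ones k = ones k + 3 ^ k * 0 by ring] at this
  obtain ⟨q, hq⟩ := this.exists_eq
  exact ⟨q, Prod.ext h hq⟩

/-- Directly to the right of the column `ones (k + 1)`, the H fractal consists of parts of height
`3 ^ k` at distance `3 ^ (k + 1)`. -/
theorem exists_abs_sub_columnPoint_le {k : ℕ} {p : ℤ × ℤ} (hp : p ∈ hFractal)
    (h₁ : ones (k + 1) ≤ p.1) (h₂ : p.1 ≤ ones (k + 1) + ones k) :
    ∃ q, |p.2 - (columnPoint (k + 1) q).2| ≤ ones k := by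
  have e₁ := two_mul_ones k
  have e₂ := ones_succ' k
  have e₃ := ones_nonneg k
  obtain ⟨q, hq⟩ := (onesLE_of_mem_hFractal hp (k + 1)).exists_abs_sub_le 0
    (by linarith) (by linarith)
  refine ⟨q, ?_⟩
  convert hq using 3
  simp only [columnPoint]
  ring

theorem exists_abs_sub_columnPoint_snd_le (k : ℕ) (y : ℤ) :
    ∃ q, |y - (columnPoint k q).2| ≤ ones k := by
  have h₁ := Int.emod_add_mul_ediv y (3 ^ k)
  have h₂ := Int.emod_nonneg y (b := 3 ^ k) (by positivity)
  have h₃ := Int.emod_lt_of_pos y (b := 3 ^ k) (by positivity)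
  have h₄ := two_mul_ones k
  refine ⟨y / 3 ^ k, ?_⟩
  rw [columnPoint, abs_le]
  constructor <;> linarith

theorem eq_of_abs_columnPoint_sub_lt {k : ℕ} {q q' : ℤ}
    (h : |(columnPoint k q).2 - (columnPoint k q').2| < 3 ^ k) : q = q' := by
  rw [abs_lt, columnPoint, columnPoint] at h
  exact eq_of_mul_sub_lt (D := 3 ^ k) (by linarith) (by linarith)

theorem zero_mem_rightBlock (k : ℕ) : (0 : ℤ × ℤ) ∈ rightBlock k :=
  ⟨le_rfl, by simpa using ones_nonneg k⟩

namespace TAS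

variable {Glue : Type*} {𝒯 : TAS Glue}

/-- The tiles in the right half of a block of height `3 ^ k` have grown from the tile at the
point `columnPoint k q` in the middle of the block. -/
def ClusterGrown (k : ℕ) (q : ℤ) (α : Assembly 𝒯.tiles) : Prop :=
  (∀ z ∈ rightBlock k, α (z + columnPoint k q) = none) ∨
    ∃ t, α (columnPoint k q) = some t ∧ RightGrown t (cluster k q α)

theorem ClusterGrown.congr {k : ℕ} {q : ℤ} {α β : Assembly 𝒯.tiles} (h : ClusterGrown k q α)
    (hαβ : ∀ z ∈ rightBlock k, β (z + columnPoint k q) = α (z + columnPoint k q)) :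
    ClusterGrown k q β := by
  rcases h with h | ⟨t, ht, h⟩
  · exact .inl fun z hz => (hαβ z hz).trans (h z hz)
  · refine .inr ⟨t, ?_, ?_⟩
    · have := hαβ 0 (zero_mem_rightBlock k)
      rw [zero_add] at this
      rw [this, ht]
    · convert h using 1
      funext z
      unfold cluster
      split_ifs with hz
      · exact hαβ z hz
      · rfl

theorem ClusterGrown.eq_none {k : ℕ} {q : ℤ} {α : Assembly 𝒯.tiles} (h : ClusterGrown k q α)
    (hq : α (columnPoint k q) = none) {z : ℤ × ℤ} (hz : z ∈ rightBlock k) :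
    α (z + columnPoint k q) = none := by
  rcases h with h | ⟨t, ht, -⟩
  · exact h z hz
  · simp [hq] at ht

theorem ClusterGrown.update {k : ℕ} {q : ℤ} {α : Assembly 𝒯.tiles} (h : ClusterGrown k q α)
    {p : ℤ × ℤ} {u : 𝒯.tiles} (hp : p - columnPoint k q ∉ rightBlock k) :
    ClusterGrown k q (Function.update α p (some u)) := by
  refine h.congr fun z hz => Function.update_of_ne ?_ _ _
  rintro rfl
  exact hp (by simpa using hz)

theorem ClusterGrown.update_columnPoint {k : ℕ} {q : ℤ} {α : Assembly 𝒯.tiles}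
    (h : ClusterGrown k q α) {u : 𝒯.tiles} (hq : α (columnPoint k q) = none) :
    ClusterGrown k q (Function.update α (columnPoint k q) (some u)) := by
  refine .inr ⟨u, by simp, ?_⟩
  convert RightGrown.base (𝒯 := 𝒯) (t := u) using 1
  funext z
  unfold cluster
  by_cases hz : z = 0
  · subst hz
    simp [zero_mem_rightBlock]
  · rw [Function.update_of_ne hz]
    split_ifs with hz'
    · rw [Function.update_of_ne (by simpa using hz)]
      exact h.eq_none hq hz'
    · rfl

theorem ClusterGrown.update_right {k : ℕ} {q : ℤ} {α : Assembly 𝒯.tiles}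
    (h : ClusterGrown k q α) {p : ℤ × ℤ} {u : 𝒯.tiles} (hτ : 0 < 𝒯.temperature)
    (hnone : α p = none) (hs : 𝒯.temperature ≤ attachStrength 𝒯.strength α p u)
    (hp : ones k < p.1) (hp' : p - columnPoint k q ∈ rightBlock k)
    (hd : ∀ d : Side, α (p + d.vec) ≠ none → p + d.vec - columnPoint k q ∈ rightBlock k) :
    ClusterGrown k q (Function.update α p (some u)) := by
  rcases h with h | ⟨t, ht, h⟩
  · obtain ⟨d, hne⟩ := exists_ne_none_of_attachStrength_pos (hτ.trans_le hs)
    have := h _ (hd d hne)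
    rw [sub_add_cancel] at this
    exact absurd this hne
  · refine .inr ⟨t, ?_, ?_⟩
    · rw [Function.update_of_ne, ht]
      rintro rfl
      exact lt_irrefl _ hp
    · convert h.step (p := p - columnPoint k q) (u := u) ?_ ?_ ?_ using 1
      · funext z
        unfold cluster
        simp only [Function.update_apply, eq_sub_iff_add_eq]
        split_ifs with h₁ h₂ h₂
        · rfl
        · rfl
        · exact absurd (by rw [← h₂] at hp'; simpa using hp') h₁
        · rfl
      · simp only [columnPoint, Prod.fst_sub]; linarith
      · simp only [cluster, if_pos hp', sub_add_cancel, hnone]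
      · refine hs.trans (attachStrength_mono u fun d hne => ?_)
        have := hd d hne
        rw [sub_add_eq_add_sub, cluster, if_pos this, sub_add_cancel]

/-- If growth to the right of the column `ones (k + 1)` from single tiles is bounded, then the
growth to the right of this column is bounded. -/
theorem fst_le_of_producible {k : ℕ} {R : ℤ} (hX : ∀ α, 𝒯.Producible α → α.dom ⊆ hFractal)
    (hτ : 0 < 𝒯.temperature) (hseed : ∀ z, 𝒯.seed z ≠ none → z.1 < ones (k + 1))
    (hR₀ : 0 ≤ R) (hR : R < ones k)
    (hbd : ∀ q t α, 𝒯.Producible α → (∀ z, α z ≠ none → z.1 ≤ ones (k + 1)) →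
      α (columnPoint (k + 1) q) = some t →
      ∀ A, RightGrown t A → ∀ z, A z ≠ none → z.1 ≤ R)
    {α : Assembly 𝒯.tiles} (hα : 𝒯.Producible α) {z : ℤ × ℤ} (hz : α z ≠ none) :
    z.1 ≤ ones (k + 1) + R := by
  have bound : ∀ α : Assembly 𝒯.tiles, 𝒯.Producible (leftPart (ones (k + 1)) α) →
      (∀ q, ClusterGrown (k + 1) q α) → ∀ z, α z ≠ none → z.1 ≤ ones (k + 1) + R := by
    intro α hl hc z hz
    by_cases hz₁ : z.1 ≤ ones (k + 1)
    · linarith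
    obtain ⟨q, hq⟩ := exists_abs_sub_columnPoint_snd_le (k + 1) z.2
    have hmem : z - columnPoint (k + 1) q ∈ rightBlock (k + 1) :=
      ⟨by simp only [columnPoint, Prod.fst_sub]; linarith, hq⟩
    rcases hc q with h | ⟨t, ht, h⟩
    · have := h _ hmem
      rw [sub_add_cancel] at this
      exact absurd this hz
    · have := hbd q t _ hl (fun z hz => ?_) ?_ _ h (z - columnPoint (k + 1) q) ?_
      · simp only [columnPoint, Prod.fst_sub] at this; linarith
      · by_contra hlt
        exact hz (if_neg hlt)
      · rw [leftPart, if_pos (by simp [columnPoint]), ht]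
      · rw [cluster, if_pos hmem, sub_add_cancel]; exact hz
  suffices H : 𝒯.Producible (leftPart (ones (k + 1)) α) ∧ ∀ q, ClusterGrown (k + 1) q α from
    bound α H.1 H.2 z hz
  have e₁ := two_mul_ones k
  have e₂ := ones_succ' k
  have e₃ : (3 : ℤ) ^ (k + 1) = 3 * 3 ^ k := by ring
  clear hz z
  induction hα with
  | refl =>
    refine ⟨?_, fun q => .inl fun z hz => ?_⟩
    · have hrefl : 𝒯.Producible 𝒯.seed := .refl
      convert hrefl using 1
      funext z
      unfold leftPart
      split_ifs with hz
      · rfl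
      · by_contra hne
        exact hz (hseed z (Ne.symm hne)).le
    · by_contra hne
      have := hseed _ hne
      simp only [columnPoint, Prod.fst_add] at this
      linarith [hz.1]
  | @tail α β hα hs ih =>
    obtain ⟨hl, hc⟩ := ih
    have hα : 𝒯.Producible α := hα
    have hβ := hα.step hs
    obtain ⟨p, u, hnone, hs, rfl⟩ := hs
    have hp : p ∈ hFractal := hX _ hβ (update_some_ne_none.2 (.inl rfl))
    have left : p.1 ≤ ones (k + 1) →
        (∀ d : Side, α (p + d.vec) ≠ none → (p + d.vec).1 ≤ ones (k + 1)) →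
        𝒯.Producible (leftPart (ones (k + 1)) (Function.update α p (some u))) := by
      intro hp' hd
      refine hl.step ⟨p, u, by simp [leftPart, hnone],
        hs.trans (attachStrength_mono u fun d hne => if_pos (hd d hne)), ?_⟩
      funext z
      simp only [leftPart, Function.update_apply]
      split_ifs with h₁ h₂ h₂
      · rfl
      · rfl
      · exact absurd (h₂ ▸ hp') h₁
      · rfl
    rcases lt_trichotomy p.1 (ones (k + 1)) with hlt | heq | hgt
    · refine ⟨left hlt.le fun d _ => ?_, fun q => (hc q).update fun hmem => ?_⟩
      · have := abs_vec_fst_le d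
        rw [abs_le] at this
        rw [Prod.fst_add]; omega
      · have := hmem.1
        simp only [columnPoint, Prod.fst_sub] at this
        linarith
    -- A neighbour to the right would lie in the cluster of this point, which is still empty, so the
    -- new tile binds to the left part alone.
    · obtain ⟨q₀, rfl⟩ := eq_columnPoint_of_mem hp heq
      refine ⟨left heq.le fun d hd => ?_, fun q => ?_⟩
      · by_contra hlt
        refine hd ?_
        rw [add_comm]
        refine (hc q₀).eq_none hnone ⟨?_, ?_⟩
        · simp only [columnPoint, Prod.fst_add] at hlt; omega
        · exact (abs_vec_snd_le d).trans (by linarith)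
      · by_cases hq : q = q₀
        · subst hq
          exact (hc q).update_columnPoint hnone
        · refine (hc q).update fun hmem => hq (eq_of_abs_columnPoint_sub_lt (k := k + 1) ?_)
          rw [abs_sub_comm]
          exact lt_of_le_of_lt hmem.2 (by linarith)
    · obtain ⟨d, hd⟩ := exists_ne_none_of_attachStrength_pos (hτ.trans_le hs)
      -- This is where `R < ones k` enters: a new tile may exceed the bound by one column and still
      -- lies where the fractal is split into parts.
      have hnear : ∀ d : Side, α (p + d.vec) ≠ none →
          p.1 ≤ ones (k + 1) + ones k ∧ ones (k + 1) ≤ (p + d.vec).1 ∧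
          (p + d.vec).1 ≤ ones (k + 1) + ones k := by
        intro d hd
        have h₁ := bound α hl hc _ hd
        have h₂ := abs_vec_fst_le d
        rw [abs_le] at h₂
        rw [Prod.fst_add] at h₁ ⊢
        refine ⟨by omega, by omega, by omega⟩
      obtain ⟨q₀, hq₀⟩ := exists_abs_sub_columnPoint_le hp hgt.le (hnear d hd).1
      refine ⟨?_, fun q => ?_⟩
      · convert hl using 1
        funext z
        simp only [leftPart, Function.update_apply]
        split_ifs with h₁ h₂
        · exact absurd (h₂ ▸ h₁) (not_le.2 hgt)
        · rfl
        · rfl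
      · by_cases hq : q = q₀
        · subst hq
          refine (hc q).update_right hτ hnone hs hgt ⟨?_, hq₀.trans (by linarith)⟩
            fun d hd => ⟨?_, ?_⟩
          · simp only [columnPoint, Prod.fst_sub]; linarith
          · have := (hnear d hd).2.1
            simp only [columnPoint, Prod.fst_sub]; linarith
          · obtain ⟨q₁, hq₁⟩ := exists_abs_sub_columnPoint_le (hX _ hα hd)
              (hnear d hd).2.1 (hnear d hd).2.2
            have h₁ := abs_vec_snd_le d
            -- The two centres differ by at most `2 * ones k + 1 = 3 ^ k`, less than the spacing 3 ^
            -- (k + 1).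
            have h₂ : q = q₁ := by
              refine eq_of_abs_columnPoint_sub_lt (k := k + 1) ?_
              rw [Prod.snd_add] at hq₁
              rw [abs_le] at h₁ hq₀ hq₁
              rw [abs_lt]
              constructor <;> linarith [ones_nonneg k]
            subst h₂
            exact hq₁.trans (by linarith)
        · refine (hc q).update fun hmem => hq (eq_of_abs_columnPoint_sub_lt (k := k + 1) ?_)
          have h₁ := hmem.2
          rw [Prod.snd_sub] at h₁
          rw [abs_le] at h₁ hq₀
          rw [abs_lt]
          constructor <;> linarith

theorem GrowsInto.exists_producible {α β : Assembly 𝒯.tiles} (h : 𝒯.GrowsInto α β)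
    (hα : 𝒯.Producible α) {z : ℤ × ℤ} (hz : z ∈ β.dom) :
    ∃ γ : Assembly 𝒯.tiles, 𝒯.Producible γ ∧ γ z ≠ none := by
  obtain ⟨s, rfl, hs, hβ⟩ := h
  have hprod : ∀ n, 𝒯.Producible (s n) := by
    intro n
    induction n with
    | zero => exact hα
    | succ n ih =>
      rcases hs n with h | h
      · exact ih.step h
      · rw [h]; exact ih
  obtain ⟨t, ht⟩ := Option.ne_none_iff_exists'.1 hz
  obtain ⟨n, hn⟩ := (hβ z t).1 ht
  exact ⟨s n, hprod n, by rw [hn]; simp⟩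

/-! ### Tile types with unbounded growth to the right -/

/-- Tiles of type `t` allow unbounded growth to the right of them. -/
def UnboundedRight (t : 𝒯.tiles) : Prop :=
  ∀ R : ℤ, ∃ A, RightGrown t A ∧ ∃ z, A z ≠ none ∧ R < z.1

/-- Everything that grows to the right of a tile of type `t` at `P` lies in the H fractal. -/
def RightGrowthFits (t : 𝒯.tiles) (P : ℤ × ℤ) : Prop :=
  ∀ A, RightGrown t A → ∀ z, A z ≠ none → z + P ∈ hFractal

theorem FinitelySelfAssembles.exists_unboundedRight (h : 𝒯.FinitelySelfAssembles hFractal)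
    (hτ : 0 < 𝒯.temperature) :
    ∃ k₀, ∀ k ≥ k₀, ∃ t : 𝒯.tiles, UnboundedRight t ∧ ∃ q, RightGrowthFits t (columnPoint k q) := by
  have hbound : ∀ t : 𝒯.tiles, ∃ R : ℤ, ¬ UnboundedRight t →
      ∀ A, RightGrown t A → ∀ z, A z ≠ none → z.1 ≤ R := by
    intro t
    by_cases ht : UnboundedRight t
    · exact ⟨0, fun h => absurd ht h⟩
    · have ht' := ht
      unfold UnboundedRight at ht'
      push Not at ht'
      obtain ⟨R, hR⟩ := ht'
      exact ⟨R, fun _ => hR⟩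
  choose R hR using hbound
  obtain ⟨M, hM⟩ := (Set.finite_range R).bddAbove
  obtain ⟨S, hS⟩ := (𝒯.seed_finite.image Prod.fst).bddAbove
  -- So large that the seed lies left of column `ones k` and `ones (k - 1)` exceeds every bound `R
  -- t`.
  refine ⟨(max M 0).toNat + S.toNat + 2, fun k hk => ?_⟩
  obtain ⟨k, rfl⟩ : ∃ j, k = j + 1 := ⟨k - 1, by omega⟩
  by_contra hcon
  push Not at hcon
  have hk₁ := natCast_le_ones k
  have hk₂ := natCast_le_ones (k + 1)
  have key : ∀ α, 𝒯.Producible α → ∀ z, α z ≠ none → z.1 ≤ ones (k + 1) + max M 0 := by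
    intro α hα z hz
    refine fst_le_of_producible (fun _ => h.dom_subset) hτ (fun z hz => ?_) (le_max_right _ _)
      ?_ ?_ hα hz
    · have := hS ⟨z, hz, rfl⟩
      omega
    · omega
    · intro q t α hα hle ht A hA z hz
      -- An unbounded `t` would contradict `hcon`: overlaying its growth gives producible
      -- assemblies, which lie in the fractal.
      refine (hR t (fun hun => hcon t hun q fun A hA z hz => ?_) A hA z hz).trans
        ((hM ⟨t, rfl⟩).trans (le_max_left _ _))
      refine h.dom_subset (hA.producible_overlay hα (by simpa [columnPoint] using hle) ht) ?_
      show (if _ then _ else _) ≠ none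
      split_ifs with hlt
      · simpa using hz
      · rcases hA.eq_zero_or_pos hz with rfl | hpos
        · simp [ht]
        · exact absurd (by simpa using hpos) hlt
  obtain ⟨β, hβ, hdom⟩ := h 𝒯.seed .refl 𝒯.seed_finite
  obtain ⟨p, hp, hlt⟩ := exists_mem_hFractal_lt (ones (k + 1) + max M 0)
  rw [← hdom] at hp
  obtain ⟨γ, hγ, hne⟩ := hβ.exists_producible .refl hp
  exact (key γ hγ p hne).not_gt hlt

end TAS

/-! ### Contraction of unbounded growth into `biFractal` -/

theorem abs_ediv_sub_ediv_le {a b d : ℤ} (hd : 0 < d) (h : |b - a| ≤ 1) : |b / d - a / d| ≤ 1 := by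
  rw [abs_le] at h ⊢
  have h₁ : b / d ≤ (a + d) / d := Int.ediv_le_ediv hd (by linarith)
  have h₂ : a / d ≤ (b + d) / d := Int.ediv_le_ediv hd (by linarith)
  rw [Int.add_ediv_of_dvd_right dvd_rfl, Int.ediv_self hd.ne'] at h₁ h₂
  omega

/-- Contraction of the blocks of side length `3 ^ l`. -/
def coarsen (l : ℕ) (q : ℤ) (z : ℤ × ℤ) : ℤ × ℤ :=
  ((z + columnPoint l q).1 / 3 ^ l, (z + columnPoint l q).2 / 3 ^ l)

theorem Near.coarsen {p p' : ℤ × ℤ} (h : Near p p') (l : ℕ) (q : ℤ) :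
    Near (coarsen l q p) (coarsen l q p') := by
  simp only [_root_.coarsen, Prod.fst_add, Prod.snd_add]
  rcases h with ⟨h₁, h₂⟩ | ⟨h₁, h₂⟩
  · exact .inl ⟨by simp only [h₁], abs_ediv_sub_ediv_le (by positivity) (by simpa using h₂)⟩
  · exact .inr ⟨by simp only [h₁], abs_ediv_sub_ediv_le (by positivity) (by simpa using h₂)⟩

/-- Dividing by 3 ^ l drops the last `l` digits, which gives the ordinary condition. For `m ≥ l +
N`, translation by `columnPoint m q'` is translation by `ones (l + N)` in both coordinates modulo 3
^ (l + N), which gives the balanced one. -/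
theorem coarsen_mem_biFractal {l : ℕ} {q : ℤ} {z : ℤ × ℤ} (h : z + columnPoint l q ∈ hFractal)
    (h' : ∀ n, ∃ m ≥ n, ∃ q', z + columnPoint m q' ∈ hFractal) : coarsen l q z ∈ biFractal q := by
  intro N
  refine ⟨(onesLE_of_mem_hFractal h (l + N)).ediv, ?_⟩
  have hpos : (3 : ℤ) ^ l ≠ 0 := by positivity
  have e₁ : (coarsen l q z).1 + ones N = (z.1 + ones (l + N)) / 3 ^ l := by
    rw [ones_add, ← add_assoc, Int.add_mul_ediv_left _ _ hpos]; rfl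
  have e₂ : (coarsen l q z).2 - q + ones N = (z.2 + ones (l + N)) / 3 ^ l := by
    rw [ones_add, ← add_assoc, Int.add_mul_ediv_left _ _ hpos]
    simp only [coarsen, columnPoint, Prod.snd_add]
    rw [← add_assoc, Int.add_mul_ediv_left _ _ hpos]
    ring
  rw [e₁, e₂]
  refine OnesLE.ediv ?_
  obtain ⟨m, hm, q', hq'⟩ := h' (l + N)
  obtain ⟨j, rfl⟩ := Nat.exists_eq_add_of_le hm
  refine OnesLE.of_add (ones j) (ones j + 3 ^ j * q') ?_
  convert (onesLE_of_mem_hFractal hq' (l + N)) using 1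
  · simp only [columnPoint, Prod.fst_add]
    rw [ones_add (l + N)]; ring
  · simp only [columnPoint, Prod.snd_add]
    rw [ones_add (l + N), pow_add 3 (l + N)]; ring

theorem LatticeJoined.coarsen {W Z : Set (ℤ × ℤ)} {p p' : ℤ × ℤ} (h : LatticeJoined W p p')
    {l : ℕ} {q : ℤ} (hW : ∀ z ∈ W, coarsen l q z ∈ Z) :
    LatticeJoined Z (coarsen l q p) (coarsen l q p') := by
  induction h with
  | refl => exact .refl
  | tail _ hs ih => exact ih.tail ⟨hs.1.coarsen l q, hW _ hs.2.1, hW _ hs.2.2⟩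

theorem TAS.UnboundedRight.not_fits {Glue : Type*} {𝒯 : TAS Glue} (hτ : 0 < 𝒯.temperature)
    {t : 𝒯.tiles} (ht : UnboundedRight t) :
    ∃ n, ∀ k ≥ n, ∀ q, ¬ RightGrowthFits t (columnPoint k q) := by
  by_contra! hfits
  obtain ⟨l, -, q, hq⟩ := hfits 0
  have hmem : ∀ A, RightGrown t A → ∀ z ∈ A.dom, coarsen l q z ∈ biFractal q := by
    intro A hA z hz
    refine coarsen_mem_biFractal (hq A hA z hz) fun n => ?_
    obtain ⟨m, hm, q', hq'⟩ := hfits n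
    exact ⟨m, hm, q', hq' A hA z hz⟩
  have e₁ := two_mul_ones l
  have e₂ := ones_nonneg l
  have h₀ : coarsen l q 0 = (0, q) := by
    simp only [coarsen, columnPoint, zero_add]
    rw [Int.add_mul_ediv_left _ _ (by positivity), Int.ediv_eq_zero_of_lt e₂ (by linarith), zero_add]
  have hq₀ : 0 ≤ q := by
    have := hq _ .base 0 (by simp)
    have := (nonneg_of_mem_hFractal this).2
    simp only [columnPoint, zero_add] at this
    by_contra hneg
    have : (3 : ℤ) ^ l * q ≤ 3 ^ l * (-1) := by gcongr; omega
    linarith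
  obtain ⟨b, hb⟩ := exists_fst_lt_of_joined hq₀
  obtain ⟨A, hA, z, hz, hlt⟩ := ht (b * 3 ^ l)
  have hj := (hA.joined hτ hz).coarsen (hmem A hA)
  have hlt' := hb _ (hmem A hA 0 (by show A 0 ≠ none; rw [hA.apply_zero]; simp)) _ (by rw [h₀]) hj
  have : b ≤ (coarsen l q z).1 := by
    refine Int.le_ediv_of_mul_le (by positivity) ?_
    simp only [columnPoint, Prod.fst_add]
    linarith
  linarith

theorem theorem1 {Glue : Type*} (𝒯 : TAS Glue) : ¬ 𝒯.FinitelySelfAssembles hFractal := by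
  intro h
  have hτ : 0 < 𝒯.temperature := by
    refine h.temperature_pos ?_ ?_
    · obtain ⟨p, hp, -⟩ := exists_mem_hFractal_lt 0
      exact ⟨p, hp⟩
    · refine (Set.ne_univ_iff_exists_notMem _).2 ⟨(-1, 0), fun hmem => ?_⟩
      have := (nonneg_of_mem_hFractal hmem).1
      norm_num at this
  obtain ⟨k₀, hk₀⟩ := h.exists_unboundedRight hτ
  have hn : ∀ t : 𝒯.tiles, ∃ n, TAS.UnboundedRight t →
      ∀ k ≥ n, ∀ q, ¬ TAS.RightGrowthFits t (columnPoint k q) := by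
    intro t
    by_cases ht : TAS.UnboundedRight t
    · obtain ⟨n, hn⟩ := ht.not_fits hτ
      exact ⟨n, fun _ => hn⟩
    · exact ⟨0, fun h => absurd h ht⟩
  choose n hn using hn
  obtain ⟨M, hM⟩ := (Set.finite_range n).bddAbove
  -- Pigeonhole: this scale is beyond the thresholds of all the finitely many tile types.
  obtain ⟨t, ht, q, hq⟩ := hk₀ (max k₀ M) (le_max_left _ _)
  exact hn t ht _ ((hM ⟨t, rfl⟩).trans (le_max_right _ _)) q hq
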